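/- Let $n$ be a natural number, write points of $\mathbb R^{2n}$ and $\mathbb C^{2n}$ as $\xi=(x,u)$, $\zeta=(z,w)$, let $[(z,w),(z',w')]=w\cdot z'-w'\cdot z$ be the complex-bilinear symplectic form, let $\zeta\cdot\zeta'$ be the bilinear dot product, and let $\lambda\in\mathbb R\setminus\{0\}$. Put $c_\lambda=(4\pi)^{-n}\lambda^n(\sinh\lambda)^{-n}$ and, for $t>0$ and $\zeta\in\mathbb C^{2n}$, $$p_t^\lambda(\zeta)=(4\pi)^{-n}\lambda^n(\sinh t\lambda)^{-n}e^{-\frac{\lambda}{4}(\coth t\lambda)\,\zeta\cdot\zeta},\qquad w_\lambda(\zeta)=c_\lambda\,e^{-\frac{\lambda}{2}(\coth\lambda)|\zeta|^2}e^{\lambda[\Re\zeta,\Im\zeta]}.$$ For $f\in L^2(\mathbb R^{2n})$ the twisted Bargmann transform is the function on $\mathbb C^{2n}$ $$B_\lambda f(\zeta)=c_\lambda\,p_1^\lambda(\zeta)^{-1}\int_{\mathbb R^{2n}}f(\eta)\,p_{1/2}^\lambda(\zeta-\eta)\,e^{-i\frac{\lambda}{2}[\zeta,\eta]}\,d\eta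 .$$ For $\zeta'\in\mathbb C^{2n}$ let $$\rho_\lambda(\zeta')F(\zeta)=F(\zeta-\zeta')\,e^{\frac{\lambda}{2}(\coth\lambda)\,\zeta\cdot\overline{\zeta'}}\,e^{-i\frac{\lambda}{2}[\zeta,\overline{\zeta'}]}\,e^{-\frac{\lambda}{4}(\coth\lambda)|\zeta'|^2}\,e^{\frac{\lambda}{2}[\Re\zeta',\Im\zeta']},$$ and $\Pi_\lambda(\xi,\eta)=B_\lambda^{-1}\circ\rho_\lambda(\xi+i\eta)\circ B_\lambda$ for $\xi,\eta\in\mathbb R^{2n}$, which acts on Schwartz functions. For $1\le p,q\le\infty$ let $L^{p,q}(\mathbb R^{2n}\times\mathbb R^{2n})$ be the space of measurable $F(\xi,\eta)$ for which the $L^q$ norm in $\eta$ of the $L^p$ norm in $\xi$ is finite. With $\langle f,g\rangle=f(\overline g)$ for a tempered distribution $f$ and a Schwartz function $g$, let $M_\lambda^{p,q}(\mathbb R^{2n})$ be the set of tempered distributions $f$ on $\mathbb R^{2n}$ such that $(\xi,\eta)\mapsto\langle f,\Pi_\lambda(\xi,\eta)g\rangle$ belongs to $L^{p,q}(\mathbb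 R^{2n}\times\mathbb R^{2n})$ for some nonzero Schwartz function $g$. Then: (a) for all $\lambda\ne0$, all $1\le p,q\le\infty$ and all $f\in L^2(\mathbb R^{2n})$, $f\in M_\lambda^{p,q}(\mathbb R^{2n})$ if and only if the function $F(\xi,\eta)=\sqrt{w_\lambda(\xi+i\eta)}\;B_\lambda f(\xi+i\eta)$ belongs to $L^{p,q}(\mathbb R^{2n}\times\mathbb R^{2n})$; (b) there is a constant $d_n>0$ depending only on $n$ such that for all $\lambda\ne0$, the restriction of $p_{1/2}^\lambda$ to $\mathbb R^{2n}$ is a Schwartz function and, for all $f\in L^2(\mathbb R^{2n})$ and $\xi,\eta\in\mathbb R^{2n}$, $$d_n\sqrt{c_\lambda}\,\langle f,\Pi_\lambda(\xi,\eta)p_{1/2}^\lambda\rangle=B_\lambda f(\xi+i\eta)\,\sqrt{w_\lambda(\xi+i\eta)} .$$ -/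

import Mathlib

open MeasureTheory Complex
open scoped SchwartzMap ENNReal ComplexConjugate Matrix

noncomputable section

namespace TwistedModulation

/-- `ℝ^{2n} = ℝⁿ × ℝⁿ`. A point is `ξ = (x, u)` with `x j = ξ (Sum.inl j)`,
`u j = ξ (Sum.inr j)`. -/
abbrev R2n (n : ℕ) : Type := EuclideanSpace ℝ (Fin n ⊕ Fin n)

/-- `ℂ^{2n} = ℂⁿ × ℂⁿ`. A point is `ζ = (z, w)` with `z j = ζ (Sum.inl j)`,
`w j = ζ (Sum.inr j)`. -/
abbrev C2n (n : ℕ) : Type := Fin n ⊕ Fin n → ℂ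

/-- The symplectic form `[(x, u), (y, v)] = u · y - v · x`, over `ℝ` and over `ℂ` (where it is
bilinear, not sesquilinear). -/
def symp {R : Type} [CommRing R] {n : ℕ} (ξ η : Fin n ⊕ Fin n → R) : R :=
  ∑ j : Fin n, (ξ (Sum.inr j) * η (Sum.inl j) - η (Sum.inr j) * ξ (Sum.inl j))

/-- The point `ξ + iη` of `ℂ^{2n}`. -/
def cplx {n : ℕ} (ξ η : R2n n) : C2n n := fun k => (ξ k : ℂ) + I * (η k : ℂ)

/-- `ξ ∈ ℝ^{2n}` as a point of `ℂ^{2n}`. -/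
def ofR {n : ℕ} (ξ : R2n n) : C2n n := fun k => (ξ k : ℂ)

/-- `|ζ|²`. -/
def absSq {n : ℕ} (ζ : C2n n) : ℝ := ∑ k, ‖ζ k‖ ^ 2

/-- The hyperbolic cotangent. -/
def coth (t : ℝ) : ℝ := Real.cosh t / Real.sinh t

/-- `c_λ = (4π)^{-n} λⁿ (sinh λ)^{-n}`. -/
def cConst (n : ℕ) (lam : ℝ) : ℝ :=
  ((4 * Real.pi) ^ n)⁻¹ * lam ^ n * ((Real.sinh lam) ^ n)⁻¹

/-- The heat kernel `p_t^λ` of the special Hermite operator, in its holomorphic extension to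
`ℂ^{2n}`: `(4π)^{-n} λⁿ (sinh tλ)^{-n} exp(-(λ/4) coth(tλ) ζ · ζ)`, with the bilinear product
`ζ · ζ`. -/
def heatKernel {n : ℕ} (lam t : ℝ) (ζ : C2n n) : ℂ :=
  ((((4 * Real.pi) ^ n)⁻¹ * lam ^ n * ((Real.sinh (t * lam)) ^ n)⁻¹ : ℝ) : ℂ) *
    cexp (-((lam / 4 * coth (t * lam) : ℝ) : ℂ) * (ζ ⬝ᵥ ζ))

/-- The holomorphic extension to `ℂ^{2n}` of the `λ`-twisted convolution `f *_λ p_t^λ`: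
`∫ f(η) p_t^λ(ζ - η) e^{-i(λ/2)[ζ, η]} dη`. -/
def heatConv {n : ℕ} (lam t : ℝ) (f : R2n n → ℂ) (ζ : C2n n) : ℂ :=
  ∫ η : R2n n, f η * heatKernel lam t (ζ - ofR η) *
    cexp (-I * ((lam / 2 : ℝ) : ℂ) * symp ζ (ofR η))

/-- The twisted Bargmann transform `B_λ f = c_λ (p_1^λ)⁻¹ (f *_λ p_{1/2}^λ)`. -/
def bargmann {n : ℕ} (lam : ℝ) (f : R2n n → ℂ) (ζ : C2n n) : ℂ :=
  (cConst n lam : ℂ) * (heatKernel lam 1 ζ)⁻¹ * heatConv lam (1 / 2) f ζ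

/-- The weight `w_λ(ζ) = c_λ e^{-(λ/2) coth λ |ζ|²} e^{λ [Re ζ, Im ζ]}` of the twisted Fock
space. -/
def weight {n : ℕ} (lam : ℝ) (ζ : C2n n) : ℝ :=
  cConst n lam * Real.exp (-(lam / 2) * coth lam * absSq ζ) *
    Real.exp (lam * symp (fun k => (ζ k).re) (fun k => (ζ k).im))

/-- The operators `ρ_λ(ζ')` acting on functions on `ℂ^{2n}` by
`ρ_λ(ζ')F(ζ) = F(ζ - ζ') e^{(λ/2) coth λ ζ·ζ̄'} e^{-i(λ/2)[ζ, ζ̄']}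
  e^{-(λ/4) coth λ |ζ'|²} e^{(λ/2)[Re ζ', Im ζ']}`. -/
def rho {n : ℕ} (lam : ℝ) (ζ' : C2n n) (F : C2n n → ℂ) (ζ : C2n n) : ℂ :=
  F (ζ - ζ') *
    cexp (((lam / 2 * coth lam : ℝ) : ℂ) * (ζ ⬝ᵥ fun k => conj (ζ' k))) *
    cexp (-I * ((lam / 2 : ℝ) : ℂ) * symp ζ (fun k => conj (ζ' k))) *
    ((Real.exp (-(lam / 4) * coth lam * absSq ζ') : ℝ) : ℂ) *
    ((Real.exp (lam / 2 * symp (fun k => (ζ' k).re) (fun k => (ζ' k).im)) : ℝ) : ℂ)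

/-- The representation operator `Π_λ(ζ) = B_λ⁻¹ ∘ ρ_λ(ζ) ∘ B_λ` on Schwartz functions: for
Schwartz `g`, `Π_λ(ζ) g` is the Schwartz function `h` with `B_λ h = ρ_λ(ζ) (B_λ g)`. -/
def repPi {n : ℕ} (lam : ℝ) (ζ : C2n n) (g : 𝓢(R2n n, ℂ)) : 𝓢(R2n n, ℂ) :=
  Function.invFun (fun h : 𝓢(R2n n, ℂ) => bargmann lam (h : R2n n → ℂ))
    (rho lam ζ (bargmann lam (g : R2n n → ℂ)))

/-- Complex conjugation of Schwartz functions. -/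
def conjS {n : ℕ} (g : 𝓢(R2n n, ℂ)) : 𝓢(R2n n, ℂ) :=
  SchwartzMap.postcompCLM (𝕜 := ℝ) (conjCLE : ℂ →L[ℝ] ℂ) g

/-- The sesquilinear pairing `⟨f, g⟩ = f(ḡ)` of a tempered distribution and a Schwartz function;
it is `∫ f ḡ` when `f` is a function. -/
def pairing {n : ℕ} (f : 𝓢'(R2n n, ℂ)) (g : 𝓢(R2n n, ℂ)) : ℂ := f (conjS g)

/-- The matrix coefficient `⟨f, Π_λ(ξ, η) g⟩`, `Π_λ(ξ, η) = Π_λ(ξ + iη)`. -/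
def matrixCoeff {n : ℕ} (lam : ℝ) (f : 𝓢'(R2n n, ℂ)) (g : 𝓢(R2n n, ℂ)) (ξ η : R2n n) : ℂ :=
  pairing f (repPi lam (cplx ξ η) g)

/-- The mixed norm: the `L^q` norm in `η` of the `L^p` norm in `ξ` (with essential suprema for
infinite exponents). -/
def mixedNorm {n : ℕ} (p q : ℝ≥0∞) (F : R2n n → R2n n → ℂ) : ℝ≥0∞ :=
  eLpNorm (fun η => eLpNorm (fun ξ => F ξ η) p volume) q volume

/-- `F ∈ L^{p,q}(ℝ^{2n} × ℝ^{2n})`. -/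
def MemMixedLp {n : ℕ} (p q : ℝ≥0∞) (F : R2n n → R2n n → ℂ) : Prop :=
  AEStronglyMeasurable (fun z : R2n n × R2n n => F z.1 z.2) (volume.prod volume) ∧
    mixedNorm p q F < ∞

/-- The twisted modulation space `M_λ^{p,q}(ℝ^{2n})`: the tempered distributions whose matrix
coefficient against some nonzero Schwartz window is in `L^{p,q}`. -/
def twistedModulationSpace (n : ℕ) (lam : ℝ) (p q : ℝ≥0∞) : Set 𝓢'(R2n n, ℂ) :=
  {f | ∃ g : 𝓢(R2n n, ℂ), g ≠ 0 ∧ MemMixedLp p q (matrixCoeff lam f g)}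

end TwistedModulation

end

/-! Everything rests on identifying `Π_λ(ξ, η)`. Put a = (λ/2) coth(λ/2) and r = tanh(λ/2), so that
ra = λ/2 and (λ/2) coth λ = (a/2)(1 + r²). In these parameters `B_λ` is a Gaussian integral
transform, and comparing exponents shows that `Π_λ(ξ, η)` is the Weyl operator g ↦ e^{-ix·y/2}
e^{iy·t} g(t - x) with x = ξ + rJη and y = raJξ - aη (`bargmann_weylShift`, `repPi_eq_weylShift`).
Matrix coefficients are therefore, up to a phase, short-time Fourier transforms composed with a
linear map, invertible because r² < 1. A second comparison of exponents, with the Gaussian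
`p_{1/2}^λ` as window, gives (b) with constant 1 (`integral_mul_conj_weylShift_window`).

By (b), the function F in (a) is a constant multiple of the matrix coefficient with Gaussian window,
so (a) says that the window does not matter (`MemMixedLp.change_window`). Moyal's formula bounds one
short-time Fourier transform by the convolution of another with an integrable kernel. The linear map
mixes ξ and η and need not preserve mixed norms, but it carries convolutions to convolutions, so
Young's inequality for mixed norms applies directly in the coordinates (ξ, η). -/

/-! ### Minkowski and Young inequalities for mixed norms -/

section MixedYoung

variable {α β : Type*} [MeasurableSpace α] [MeasurableSpace β]

/-- For finite `p` this is Tonelli. For `p = ∞` the essential supremum exceeds `c` exactly when the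
slice of the superlevel set has positive measure. -/
theorem measurable_eLpNorm_fiber {μ : Measure α} [SFinite μ] {p : ℝ≥0∞} (hp : 1 ≤ p)
    {f : α × β → ℝ≥0∞} (hf : Measurable f) :
    Measurable fun y => eLpNorm (fun x => f (x, y)) p μ := by
  by_cases htop : p = ∞
  · subst htop
    refine measurable_of_Ioi fun c => ?_
    have hset : (fun y => eLpNorm (fun x => f (x, y)) ∞ μ) ⁻¹' Set.Ioi c =
        (fun y => μ ((fun x => (x, y)) ⁻¹' (f ⁻¹' Set.Ioi c))) ⁻¹' {0}ᶜ := by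
      ext y
      simp only [Set.mem_preimage, Set.mem_Ioi, Set.mem_compl_iff, Set.mem_singleton_iff]
      rw [← not_le, not_iff_not, eLpNorm_exponent_top]
      have h0 : μ ((fun x => (x, y)) ⁻¹' (f ⁻¹' Set.Ioi c)) = 0 ↔ ∀ᵐ x ∂μ, f (x, y) ≤ c := by
        rw [ae_iff]
        simp only [not_le]
        rfl
      rw [h0]
      constructor
      · intro h
        filter_upwards [enorm_ae_le_eLpNormEssSup (fun x => f (x, y)) μ] with x hx
        exact hx.trans h
      · intro h
        exact essSup_le_of_ae_le c h
    rw [hset]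
    exact measurable_measure_prodMk_right (hf measurableSet_Ioi)
      (MeasurableSet.singleton (0 : ℝ≥0∞)).compl
  · have hp0 : p ≠ 0 := (zero_lt_one.trans_le hp).ne'
    simp only [eLpNorm_eq_lintegral_rpow_enorm_toReal hp0 htop, enorm_eq_self]
    exact ((hf.pow_const _).lintegral_prod_left').pow_const _

/-- **Minkowski's integral inequality.** -/
theorem eLpNorm_lintegral_le {μ : Measure α} {ν : Measure β} [SFinite μ] [SFinite ν]
    {p : ℝ≥0∞} (hp : 1 ≤ p) {f : α × β → ℝ≥0∞} (hf : Measurable f) :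
    eLpNorm (fun x => ∫⁻ y, f (x, y) ∂ν) p μ ≤ ∫⁻ y, eLpNorm (fun x => f (x, y)) p μ ∂ν := by
  have hφm := measurable_eLpNorm_fiber (μ := μ) hp hf
  have hfy : ∀ y, Measurable fun x => f (x, y) := fun y => hf.comp measurable_prodMk_right
  have hfx : ∀ x, Measurable fun y => f (x, y) := fun x => hf.comp measurable_prodMk_left
  set φ : β → ℝ≥0∞ := fun y => eLpNorm (fun x => f (x, y)) p μ with hφ
  by_cases htop : p = ∞
  · subst htop
    have hle : ∀ᵐ z ∂(ν.prod μ), f (z.2, z.1) ≤ φ z.1 := by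
      rw [ae_iff, Measure.measure_prod_null]
      · refine Filter.Eventually.of_forall fun y => ?_
        have := enorm_ae_le_eLpNormEssSup (fun x => f (x, y)) μ
        rw [ae_iff] at this
        simpa [hφ, eLpNorm_exponent_top] using this
      · exact (measurableSet_le (hf.comp measurable_swap) (hφm.comp measurable_fst)).compl
    have hle' : ∀ᵐ x ∂μ, ∀ᵐ y ∂ν, f (x, y) ≤ φ y :=
      Measure.ae_ae_of_ae_prod (Measure.measurePreserving_swap.quasiMeasurePreserving.ae hle)
    rw [eLpNorm_exponent_top]
    refine essSup_le_of_ae_le _ ?_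
    filter_upwards [hle'] with x hx
    exact lintegral_mono_ae hx
  have hp0 : p ≠ 0 := (zero_lt_one.trans_le hp).ne'
  rcases hp.eq_or_lt with rfl | hp1
  · simp only [hφ, eLpNorm_one_eq_lintegral_enorm, enorm_eq_self]
    exact (lintegral_lintegral_swap (f := fun x y => f (x, y)) hf.aemeasurable).le
  set M : ℝ≥0∞ := ∫⁻ y, φ y ∂ν with hM
  by_cases hMtop : M = ∞
  · rw [hMtop]; exact le_top
  set r : ℝ := p.toReal with hr
  have hr1 : 1 < r := by
    rw [hr, ← ENNReal.toReal_one]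
    exact (ENNReal.toReal_lt_toReal ENNReal.one_ne_top htop).2 hp1
  have hr0 : 0 < r := zero_lt_one.trans hr1
  have hφr : ∀ y, φ y ^ r = ∫⁻ x, f (x, y) ^ r ∂μ := fun y => by
    simp only [hφ, eLpNorm_eq_lintegral_rpow_enorm_toReal hp0 htop, enorm_eq_self]
    rw [← ENNReal.rpow_mul, one_div, inv_mul_cancel₀ hr0.ne', ENNReal.rpow_one]
  have hconj : r.HolderConjugate r.conjExponent := Real.HolderConjugate.conjExponent hr1
  set q := r.conjExponent
  have hq0 : 0 < q := hconj.symm.pos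
  have hφtop : ∀ᵐ y ∂ν, φ y < ∞ := ae_lt_top hφm hMtop
  -- The negative power of `φ` used below is infinite where `φ` vanishes; there `f` vanishes almost
  -- everywhere, so the splitting survives.
  have hzero : ∀ᵐ z ∂(ν.prod μ), φ z.1 = 0 → f (z.2, z.1) = 0 := by
    rw [ae_iff, Measure.measure_prod_null]
    · refine Filter.Eventually.of_forall fun y => ?_
      by_cases hy : φ y = 0
      · have h1 : ∫⁻ x, f (x, y) ^ r ∂μ = 0 := by rw [← hφr, hy, ENNReal.zero_rpow_of_pos hr0]
        rw [lintegral_eq_zero_iff ((hfy y).pow_const _)] at h1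
        have h2 : ∀ᵐ x ∂μ, f (x, y) = 0 := by
          filter_upwards [h1] with x hx
          exact (ENNReal.rpow_eq_zero_iff_of_pos hr0).1 hx
        rw [ae_iff] at h2
        simpa [hy] using h2
      · simp [hy]
    · have h1 : MeasurableSet {z : β × α | φ z.1 = 0} :=
        (hφm.comp measurable_fst) (MeasurableSet.singleton 0)
      have h2 : MeasurableSet {z : β × α | f (z.2, z.1) = 0} :=
        (hf.comp measurable_swap) (MeasurableSet.singleton 0)
      exact (h1.imp h2).compl
  have hzero' : ∀ᵐ x ∂μ, ∀ᵐ y ∂ν, φ y = 0 → f (x, y) = 0 :=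
    Measure.ae_ae_of_ae_prod (Measure.measurePreserving_swap.quasiMeasurePreserving.ae hzero)
  -- Hölder for f = (f φ^{-1/q}) · φ^{1/q}: weighting by the fibre norm replaces the usual duality
  -- argument. Integrating in x then turns f^r into φ^r, and φ^r φ^{-(r-1)} = φ.
  have hpt : ∀ᵐ x ∂μ, (∫⁻ y, f (x, y) ∂ν) ^ r ≤
      (∫⁻ y, f (x, y) ^ r * φ y ^ (-(r / q)) ∂ν) * M ^ (r / q) := by
    filter_upwards [hzero'] with x hx
    have h1 : ∫⁻ y, f (x, y) ∂ν ≤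
        ∫⁻ y, ((fun y => f (x, y) * φ y ^ (-(1 / q))) * fun y => φ y ^ (1 / q)) y ∂ν := by
      refine lintegral_mono_ae ?_
      filter_upwards [hx, hφtop] with y h0 ht
      by_cases hy : φ y = 0
      · simp [h0 hy]
      · simp only [Pi.mul_apply]
        rw [mul_assoc, ← ENNReal.rpow_add _ _ hy ht.ne]
        simp
    have h2 := ENNReal.lintegral_mul_le_Lp_mul_Lq ν hconj
      (f := fun y => f (x, y) * φ y ^ (-(1 / q))) (g := fun y => φ y ^ (1 / q))
      ((hfx x).mul (hφm.pow_const _)).aemeasurable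
      (hφm.pow_const _).aemeasurable
    have h3 : ∫⁻ y, (φ y ^ (1 / q)) ^ q ∂ν = M := by
      simp only [← ENNReal.rpow_mul, one_div, inv_mul_cancel₀ hq0.ne', ENNReal.rpow_one, hM]
    have h4 : ∀ y, (f (x, y) * φ y ^ (-(1 / q))) ^ r = f (x, y) ^ r * φ y ^ (-(r / q)) := fun y => by
      rw [ENNReal.mul_rpow_of_nonneg _ _ hr0.le, ← ENNReal.rpow_mul]
      congr 2
      ring
    rw [h3] at h2
    simp only [h4] at h2
    refine (ENNReal.rpow_le_rpow (h1.trans h2) hr0.le).trans (le_of_eq ?_)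
    rw [ENNReal.mul_rpow_of_nonneg _ _ hr0.le, ← ENNReal.rpow_mul, ← ENNReal.rpow_mul, one_div,
      inv_mul_cancel₀ hr0.ne', ENNReal.rpow_one]
    congr 2
    ring
  have hrq : r / q = r - 1 := by
    have h := hconj.inv_add_inv_eq_one
    field_simp at h ⊢
    linarith
  have hint : ∫⁻ x, (∫⁻ y, f (x, y) ∂ν) ^ r ∂μ ≤ M ^ r := by
    calc ∫⁻ x, (∫⁻ y, f (x, y) ∂ν) ^ r ∂μ
        ≤ ∫⁻ x, (∫⁻ y, f (x, y) ^ r * φ y ^ (-(r / q)) ∂ν) * M ^ (r / q) ∂μ :=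
          lintegral_mono_ae hpt
      _ = (∫⁻ y, φ y ^ r * φ y ^ (-(r / q)) ∂ν) * M ^ (r / q) := by
          have hm : Measurable fun z : α × β => f z ^ r * φ z.2 ^ (-(r / q)) :=
            (hf.pow_const _).mul ((hφm.comp measurable_snd).pow_const _)
          rw [lintegral_mul_const _ hm.lintegral_prod_right',
            lintegral_lintegral_swap
              (f := fun x y => f (x, y) ^ r * φ y ^ (-(r / q))) hm.aemeasurable]
          congr 1
          refine lintegral_congr fun y => ?_
          rw [lintegral_mul_const _ ((hfy y).pow_const _), ← hφr]
      _ ≤ (∫⁻ y, φ y ∂ν) * M ^ (r / q) := by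
          gcongr ?_ * _
          refine lintegral_mono_ae ?_
          filter_upwards [hφtop] with y ht
          by_cases hy : φ y = 0
          · simp [hy, hr0]
          · rw [← ENNReal.rpow_add _ _ hy ht.ne, hrq]
            simp
      _ = M ^ r := by
          rw [← hM, hrq]
          by_cases h0 : M = 0
          · rw [h0, zero_mul, ENNReal.zero_rpow_of_pos hr0]
          · nth_rewrite 1 [← ENNReal.rpow_one M]
            rw [← ENNReal.rpow_add _ _ h0 hMtop]
            congr 1
            ring
  rw [eLpNorm_eq_lintegral_rpow_enorm_toReal hp0 htop]
  simp only [enorm_eq_self]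
  calc (∫⁻ x, (∫⁻ y, f (x, y) ∂ν) ^ r ∂μ) ^ (1 / r) ≤ (M ^ r) ^ (1 / r) :=
        ENNReal.rpow_le_rpow hint (by positivity)
    _ = M := by rw [← ENNReal.rpow_mul, mul_one_div_cancel hr0.ne', ENNReal.rpow_one]

theorem eLpNorm_comp_sub_right {G : Type*} [AddCommGroup G] [MeasurableSpace G]
    [MeasurableAdd₂ G] [MeasurableSub₂ G] {μ : Measure G} [μ.IsAddRightInvariant] (p : ℝ≥0∞)
    {F : G → ℝ≥0∞} (hF : Measurable F) (a : G) :
    eLpNorm (fun ξ => F (ξ - a)) p μ = eLpNorm F p μ :=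
  eLpNorm_comp_measurePreserving hF.aestronglyMeasurable (measurePreserving_sub_right μ a)

/-- Young's inequality for mixed norms and convolution with a measure. -/
theorem mixed_young {G : Type*} [AddCommGroup G] [MeasurableSpace G] [MeasurableAdd₂ G]
    [MeasurableSub₂ G]
    {μ : Measure G} [SFinite μ] [μ.IsAddRightInvariant] {ν : Measure (G × G)} [SFinite ν]
    {p q : ℝ≥0∞} (hp : 1 ≤ p) (hq : 1 ≤ q) {F : G × G → ℝ≥0∞} (hF : Measurable F) :
    eLpNorm (fun η => eLpNorm (fun ξ => ∫⁻ w, F (ξ - w.1, η - w.2) ∂ν) p μ) q μ ≤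
      eLpNorm (fun η => eLpNorm (fun ξ => F (ξ, η)) p μ) q μ * ν Set.univ := by
  have hφm := measurable_eLpNorm_fiber (μ := μ) hp hF
  -- Minkowski moves the inner norm under the integral and translation invariance removes `w.1`; the
  -- same two steps in `η` then remove `w.2`.
  have h1 : ∀ η, eLpNorm (fun ξ => ∫⁻ w, F (ξ - w.1, η - w.2) ∂ν) p μ ≤
      ∫⁻ w, (fun η => eLpNorm (fun ξ => F (ξ, η)) p μ) (η - w.2) ∂ν := by
    intro η
    have hm : Measurable fun z : G × (G × G) => F (z.1 - z.2.1, η - z.2.2) :=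
      hF.comp ((measurable_fst.sub measurable_snd.fst).prodMk
        (measurable_const.sub measurable_snd.snd))
    refine (eLpNorm_lintegral_le (ν := ν) hp hm).trans (le_of_eq ?_)
    refine lintegral_congr fun w => ?_
    have hm' : Measurable fun ξ => F (ξ, η - w.2) := hF.comp measurable_prodMk_right
    exact eLpNorm_comp_sub_right p hm' w.1
  generalize (fun η => eLpNorm (fun ξ => F (ξ, η)) p μ) = φ at hφm h1 ⊢
  have hm : Measurable fun z : G × (G × G) => φ (z.1 - z.2.2) :=
    hφm.comp (measurable_fst.sub measurable_snd.snd)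
  have h2 : eLpNorm (fun η => eLpNorm (fun ξ => ∫⁻ w, F (ξ - w.1, η - w.2) ∂ν) p μ) q μ ≤
      eLpNorm (fun η => ∫⁻ w, φ (η - w.2) ∂ν) q μ := eLpNorm_mono_enorm h1
  have h3 := eLpNorm_lintegral_le (μ := μ) (ν := ν) hq hm
  have h4 : ∀ w : G × G, eLpNorm (fun η => φ (η - w.2)) q μ = eLpNorm φ q μ :=
    fun w => eLpNorm_comp_sub_right q hφm w.2
  simp only [h4, lintegral_const] at h3
  exact h2.trans h3

end MixedYoung

/-! ### Short-time Fourier transform with Schwartz windows -/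

section TimeFrequency

open FourierTransform
open scoped RealInnerProductSpace

/-- Pointwise product of a Schwartz function and the conjugate of another one. -/
noncomputable def mulConj {E : Type*} [NormedAddCommGroup E] [NormedSpace ℝ E]
    (h g : 𝓢(E, ℂ)) : 𝓢(E, ℂ) :=
  SchwartzMap.smulLeftCLM ℂ (fun t => conj (g t)) h

theorem mulConj_apply {E : Type*} [NormedAddCommGroup E] [NormedSpace ℝ E]
    (h g : 𝓢(E, ℂ)) (t : E) : mulConj h g t = h t * conj (g t) := by
  have hg : Function.HasTemperateGrowth fun t => conj (g t) :=
    (SchwartzMap.postcompCLM (𝕜 := ℝ) (conjCLE : ℂ →L[ℝ] ℂ) g).hasTemperateGrowth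
  rw [mulConj, SchwartzMap.smulLeftCLM_apply_apply hg, smul_eq_mul, mul_comm]

variable {E : Type*} [NormedAddCommGroup E] [InnerProductSpace ℝ E] [FiniteDimensional ℝ E]
  [MeasurableSpace E] [BorelSpace E]

/-- The time-frequency shift `t ↦ e^{2πi⟪t, ω⟫} g (t - x)` of a Schwartz function. -/
noncomputable def tfShift (x ω : E) (g : 𝓢(E, ℂ)) : 𝓢(E, ℂ) :=
  𝓕⁻ ((𝓕 (g.compSubConstCLM ℂ x)).compSubConstCLM ℂ ω)

/-- Defining the modulation as a translation on the Fourier side makes it a Schwartz function at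
once; the pointwise formula is recovered here by Fourier inversion. -/
theorem tfShift_apply (x ω : E) (g : 𝓢(E, ℂ)) (t : E) :
    tfShift x ω g t = (Real.fourierChar ⟪t, ω⟫ : ℂ) * g (t - x) := by
  have h1 : g (t - x) = 𝓕⁻ (𝓕 (g.compSubConstCLM ℂ x)) t := by
    rw [FourierTransform.fourierInv_fourier_eq]
    rfl
  rw [tfShift, h1]
  simp only [SchwartzMap.fourierInv_coe, Real.fourierInv_eq, Circle.smul_def, smul_eq_mul,
    SchwartzMap.compSubConstCLM_apply]
  rw [← integral_const_mul, ← integral_add_right_eq_self _ ω]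
  refine integral_congr_ae (Filter.Eventually.of_forall fun v => ?_)
  simp only [add_sub_cancel_right, inner_add_left, AddChar.map_add_eq_mul, Circle.coe_mul,
    real_inner_comm t ω]
  ring

theorem norm_tfShift (x ω : E) (g : 𝓢(E, ℂ)) (t : E) : ‖tfShift x ω g t‖ = ‖g (t - x)‖ := by
  rw [tfShift_apply, norm_mul, Circle.norm_coe, one_mul]

theorem fourier_tfShift (x ω : E) (g : 𝓢(E, ℂ)) (s : E) :
    𝓕 (tfShift x ω g) s = (Real.fourierChar (-⟪x, s - ω⟫) : ℂ) * 𝓕 g (s - ω) := by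
  rw [tfShift, FourierTransform.fourier_fourierInv_eq, SchwartzMap.compSubConstCLM_apply]
  simp only [SchwartzMap.fourier_coe, Real.fourier_eq, Circle.smul_def, smul_eq_mul,
    SchwartzMap.compSubConstCLM_apply]
  rw [← integral_const_mul, ← integral_add_right_eq_self _ x]
  refine integral_congr_ae (Filter.Eventually.of_forall fun v => ?_)
  simp only [add_sub_cancel_right, inner_add_left, neg_add, AddChar.map_add_eq_mul,
    Circle.coe_mul]
  ring

/-- The short-time Fourier transform of `f` with window `g`. -/
noncomputable def stft (f : E → ℂ) (g : 𝓢(E, ℂ)) (z : E × E) : ℂ :=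
  ∫ t, f t * conj (tfShift z.1 z.2 g t)

theorem stft_eq_fourier (f : E → ℂ) (g : 𝓢(E, ℂ)) (z : E × E) :
    stft f g z = 𝓕 (fun t => f t * conj (g (t - z.1))) z.2 := by
  rw [stft, Real.fourier_eq]
  refine integral_congr_ae (Filter.Eventually.of_forall fun t => ?_)
  simp only [tfShift_apply, map_mul, Circle.smul_def, smul_eq_mul, AddChar.map_neg_eq_inv,
    Circle.coe_inv_eq_conj]
  ring

theorem continuous_tfShift_uncurry (g : 𝓢(E, ℂ)) :
    Continuous fun p : (E × E) × E => tfShift p.1.1 p.1.2 g p.2 := by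
  simp only [tfShift_apply]
  exact (continuous_subtype_val.comp (Real.continuous_fourierChar.comp
    (continuous_snd.inner continuous_fst.snd))).mul
    (g.continuous.comp (continuous_snd.sub continuous_fst.fst))

theorem stronglyMeasurable_stft {f : E → ℂ} (hf : AEStronglyMeasurable f volume) (g : 𝓢(E, ℂ)) :
    StronglyMeasurable (stft f g) := by
  have h : stft f g = stft (hf.mk f) g := by
    ext z
    refine integral_congr_ae ?_
    filter_upwards [hf.ae_eq_mk] with t ht
    rw [ht]
  rw [h]
  refine StronglyMeasurable.integral_prod_right
    (f := fun (z : E × E) t => hf.mk f t * conj (tfShift z.1 z.2 g t)) ?_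
  exact (hf.stronglyMeasurable_mk.comp_measurable measurable_snd).mul
    (continuous_conj.comp (continuous_tfShift_uncurry g)).stronglyMeasurable

/-- Moyal's formula for the frequency variable. -/
theorem integral_stft_mul_stft {f : E → ℂ} (hf : MemLp f 2) (h g : 𝓢(E, ℂ)) (x : E) :
    ∫ ω, stft f g (x, ω) * conj (stft h g (x, ω)) =
      ∫ t, f t * conj (h t) * (‖g (t - x)‖ ^ 2 : ℝ) := by
  set φ : 𝓢(E, ℂ) := mulConj h (g.compSubConstCLM ℂ x) with hφ
  have hφa : ∀ t, φ t = h t * conj (g (t - x)) := fun t => by rw [hφ, mulConj_apply]; rfl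
  have hgx : MemLp (fun t => conj (g (t - x))) 2 := by
    have := ((g.compSubConstCLM ℂ x).memLp 2).star
    exact this
  have hu : Integrable fun t => f t * conj (g (t - x)) := hf.integrable_mul hgx
  -- The first factor is merely integrable and the second is `𝓕 φ` with `φ` Schwartz, so the
  -- multiplication formula for integrable functions suffices and no L² Fourier theory is used.
  have key := VectorFourier.integral_sesq_fourierIntegral_eq_neg_flip (innerSL ℂ)
    (L := innerₗ E) (f := fun t => f t * conj (g (t - x))) (g := (𝓕 φ : 𝓢(E, ℂ)))
    (μ := volume) (ν := volume)
    Real.continuous_fourierChar continuous_inner hu (𝓕 φ).integrable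
  have h1 : ∀ t, VectorFourier.fourierIntegral Real.fourierChar volume (-(innerₗ E).flip)
      (𝓕 φ : 𝓢(E, ℂ)) t = φ t := by
    intro t
    have h2 : φ t = 𝓕⁻ (𝓕 φ) t := by rw [FourierTransform.fourierInv_fourier_eq]
    rw [h2, SchwartzMap.fourierInv_coe]
    simp [VectorFourier.fourierIntegral, Real.fourierInv_eq]
  simp only [h1, innerSL_apply_apply, RCLike.inner_apply] at key
  have key2 := congrArg conj key
  rw [← integral_conj, ← integral_conj] at key2
  convert key2 using 1
  · refine integral_congr_ae (Filter.Eventually.of_forall fun ω => ?_)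
    simp only [stft_eq_fourier, map_mul, conj_conj]
    rw [mul_comm, SchwartzMap.fourier_coe, show (φ : E → ℂ) = _ from funext hφa]
    rfl
  · refine integral_congr_ae (Filter.Eventually.of_forall fun t => ?_)
    simp only [hφa, map_mul, conj_conj]
    rw [← Complex.normSq_eq_norm_sq, Complex.normSq_eq_conj_mul_self]
    ring

/-- This is the integrand of a convolution of two integrable functions, f h̄ and |g(-·)|². -/
theorem integrable_moyal {f : E → ℂ} (hf : MemLp f 2) (h g : 𝓢(E, ℂ)) :
    Integrable (fun p : E × E => f p.2 * conj (h p.2) * (‖g (p.2 - p.1)‖ ^ 2 : ℝ))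
      (volume.prod volume) := by
  have h1 : Integrable fun t => f t * conj (h t) := by
    have := (h.memLp 2 (μ := volume)).star
    exact hf.integrable_mul this
  have h2 : Integrable fun t => ((‖g (-t)‖ ^ 2 : ℝ) : ℂ) :=
    ((g.memLp 2 (μ := volume)).integrable_norm_pow two_ne_zero).comp_neg.ofReal
  have := h1.convolution_integrand (ContinuousLinearMap.mul ℂ ℂ) h2
  simpa using this

/-- Moyal's formula, as a bound. -/
theorem moyal_bound {f : E → ℂ} (hf : MemLp f 2) (h g : 𝓢(E, ℂ)) :
    ENNReal.ofReal (∫ t, ‖g t‖ ^ 2) * ‖∫ t, f t * conj (h t)‖ₑ ≤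
      ∫⁻ w : E × E, ‖stft f g w‖ₑ * ‖stft h g w‖ₑ := by
  have hx : ∀ t : E, ∫ x, ((‖g (t - x)‖ ^ 2 : ℝ) : ℂ) = ((∫ t, ‖g t‖ ^ 2 : ℝ) : ℂ) := fun t => by
    rw [integral_complex_ofReal, integral_sub_left_eq_self (fun s => ‖g s‖ ^ 2) volume t]
  -- Fubini is applied only after the frequency integral has been evaluated, so joint integrability
  -- of the product of the two transforms is not needed.
  have h1 : ((∫ t, ‖g t‖ ^ 2 : ℝ) : ℂ) * ∫ t, f t * conj (h t) =
      ∫ x, ∫ ω, stft f g (x, ω) * conj (stft h g (x, ω)) := by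
    simp only [integral_stft_mul_stft hf]
    rw [integral_integral_swap (integrable_moyal hf h g)]
    simp only [integral_const_mul, hx]
    rw [integral_mul_const, mul_comm]
  have h2 := congrArg enorm h1
  rw [enorm_mul, ← ofReal_norm, Complex.norm_real, Real.norm_of_nonneg
    (integral_nonneg fun t => by positivity)] at h2
  rw [h2]
  have hm : Measurable fun w : E × E => ‖stft f g w‖ₑ * ‖stft h g w‖ₑ :=
    (stronglyMeasurable_stft hf.1 g).measurable.enorm.mul
      (stronglyMeasurable_stft h.continuous.aestronglyMeasurable g).measurable.enorm
  rw [Measure.volume_eq_prod, lintegral_prod _ hm.aemeasurable]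
  refine (enorm_integral_le_lintegral_enorm _).trans (lintegral_mono fun x => ?_)
  refine (enorm_integral_le_lintegral_enorm _).trans (le_of_eq (lintegral_congr fun ω => ?_))
  rw [enorm_mul, RCLike.enorm_conj]

/-- Time-frequency shifts compose up to a phase. This is what turns Moyal's formula into a
convolution bound. -/
theorem norm_stft_tfShift (h g : 𝓢(E, ℂ)) (z w : E × E) :
    ‖stft (tfShift z.1 z.2 h) g w‖ = ‖stft h g (w - z)‖ := by
  have h1 : stft (tfShift z.1 z.2 h) g w =
      (Real.fourierChar ⟪z.1, z.2 - w.2⟫ : ℂ) * stft h g (w - z) := by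
    rw [stft, stft, ← integral_const_mul, ← integral_add_right_eq_self _ z.1]
    refine integral_congr_ae (Filter.Eventually.of_forall fun t => ?_)
    simp only [tfShift_apply, map_mul, ← Circle.coe_inv_eq_conj, ← AddChar.map_neg_eq_inv,
      Prod.fst_sub, Prod.snd_sub, add_sub_cancel_right]
    rw [show t + z.1 - w.1 = t - (w.1 - z.1) by abel]
    have : Real.fourierChar ⟪t + z.1, z.2⟫ * Real.fourierChar (-⟪t + z.1, w.2⟫) =
        Real.fourierChar ⟪z.1, z.2 - w.2⟫ * Real.fourierChar (-⟪t, w.2 - z.2⟫) := by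
      rw [← AddChar.map_add_eq_mul, ← AddChar.map_add_eq_mul]
      congr 1
      simp only [inner_add_left, inner_sub_right]
      ring
    have := congrArg (fun c : Circle => (c : ℂ)) this
    simp only [Circle.coe_mul] at this
    linear_combination (h t * conj (g (t - (w.1 - z.1)))) * this
  rw [h1, norm_mul, Circle.norm_coe, one_mul]

/-- Change of window for the short-time Fourier transform. -/
theorem change_of_window {f : E → ℂ} (hf : MemLp f 2) (h g : 𝓢(E, ℂ)) (z : E × E) :
    ENNReal.ofReal (∫ t, ‖g t‖ ^ 2) * ‖stft f h z‖ₑ ≤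
      ∫⁻ w : E × E, ‖stft f g w‖ₑ * ‖stft h g (w - z)‖ₑ := by
  refine (moyal_bound hf (tfShift z.1 z.2 h) g).trans (le_of_eq (lintegral_congr fun w => ?_))
  rw [← ofReal_norm (stft (tfShift z.1 z.2 h) g w), norm_stft_tfShift,
    ofReal_norm]

/-- From 1 + ‖x‖ ≤ (1 + ‖t‖)(1 + ‖t - x‖): one factor is absorbed by the decay of `v`, the other by
the moments of `u`. -/
theorem exists_integral_mul_translate_le (u v : 𝓢(E, ℂ)) (N : ℕ) :
    ∃ C, 0 ≤ C ∧ ∀ x, ∫ t, ‖u t‖ * ‖v (t - x)‖ ≤ C * ((1 + ‖x‖) ^ N)⁻¹ := by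
  obtain ⟨A, hA0, hA⟩ : ∃ A, 0 ≤ A ∧ ∀ t, (1 + ‖t‖) ^ N * ‖v t‖ ≤ A := by
    refine ⟨2 ^ N * ((Finset.Iic (N, 0)).sup fun m => SchwartzMap.seminorm ℝ m.1 m.2) v,
      by positivity, fun t => ?_⟩
    simpa using SchwartzMap.one_add_le_sup_seminorm_apply (𝕜 := ℝ) (m := (N, 0)) le_rfl le_rfl v t
  have hu : Integrable fun t => (1 + ‖t‖) ^ N * ‖u t‖ := by
    simp only [add_pow, one_pow, one_mul, Finset.sum_mul]
    refine integrable_finsetSum _ fun i _ => ?_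
    have := (u.integrable_pow_mul volume (N - i)).mul_const (N.choose i : ℝ)
    refine this.congr (Filter.Eventually.of_forall fun t => ?_)
    simp only
    ring
  refine ⟨A * ∫ t, (1 + ‖t‖) ^ N * ‖u t‖, by positivity, fun x => ?_⟩
  rw [mul_assoc, ← integral_mul_const, ← integral_const_mul]
  refine integral_mono_of_nonneg (Filter.Eventually.of_forall fun t => by positivity)
    ((hu.mul_const _).const_mul _) (Filter.Eventually.of_forall fun t => ?_)
  simp only
  have hx : (1 + ‖x‖) ^ N ≤ (1 + ‖t‖) ^ N * (1 + ‖t - x‖) ^ N := by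
    rw [← mul_pow]
    refine pow_le_pow_left₀ (by positivity) ?_ N
    have : ‖x‖ ≤ ‖t‖ + ‖t - x‖ := by
      calc ‖x‖ = ‖t - (t - x)‖ := by rw [sub_sub_cancel]
        _ ≤ _ := norm_sub_le _ _
    nlinarith [norm_nonneg t, norm_nonneg (t - x)]
  have hp : 0 < (1 + ‖x‖) ^ N := by positivity
  rw [← div_eq_mul_inv, ← mul_div_assoc, le_div_iff₀ hp]
  calc ‖u t‖ * ‖v (t - x)‖ * (1 + ‖x‖) ^ N
      ≤ ‖u t‖ * ‖v (t - x)‖ * ((1 + ‖t‖) ^ N * (1 + ‖t - x‖) ^ N) := by gcongr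
    _ = ((1 + ‖t - x‖) ^ N * ‖v (t - x)‖) * ((1 + ‖t‖) ^ N * ‖u t‖) := by ring
    _ ≤ A * ((1 + ‖t‖) ^ N * ‖u t‖) := by
        gcongr
        exact hA _

theorem stft_eq_fourier_fourier (h g : 𝓢(E, ℂ)) (z : E × E) :
    stft h g z = ∫ s, 𝓕 h s * conj (𝓕 (tfShift z.1 z.2 g) s) := by
  have := SchwartzMap.integral_inner_fourier_fourier (tfShift z.1 z.2 g) h
  simp only [RCLike.inner_apply] at this
  exact this.symm

/-- The definition gives decay in position and Parseval gives decay in frequency. The geometric mean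
of the two bounds decays in both, which is why each is taken with exponent `2 * N`. -/
theorem exists_norm_stft_le (h g : 𝓢(E, ℂ)) (N : ℕ) :
    ∃ C, 0 ≤ C ∧ ∀ z : E × E,
      ‖stft h g z‖ ≤ C * (((1 + ‖z.1‖) ^ N)⁻¹ * ((1 + ‖z.2‖) ^ N)⁻¹) := by
  obtain ⟨A, hA0, hA⟩ := exists_integral_mul_translate_le h g (2 * N)
  obtain ⟨B, hB0, hB⟩ := exists_integral_mul_translate_le (𝓕 h) (𝓕 g) (2 * N)
  refine ⟨√(A * B), by positivity, fun z => ?_⟩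
  have h1 : ‖stft h g z‖ ≤ A * ((1 + ‖z.1‖) ^ (2 * N))⁻¹ := by
    refine (norm_integral_le_integral_norm _).trans (le_trans (le_of_eq ?_) (hA z.1))
    simp only [norm_mul, RCLike.norm_conj, norm_tfShift]
  have h2 : ‖stft h g z‖ ≤ B * ((1 + ‖z.2‖) ^ (2 * N))⁻¹ := by
    rw [stft_eq_fourier_fourier]
    refine (norm_integral_le_integral_norm _).trans (le_trans (le_of_eq ?_) (hB z.2))
    simp only [norm_mul, RCLike.norm_conj, fourier_tfShift, Circle.norm_coe, one_mul]
  refine abs_le_of_sq_le_sq' ?_ (by positivity) |>.2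
  calc ‖stft h g z‖ ^ 2 = ‖stft h g z‖ * ‖stft h g z‖ := sq _
    _ ≤ (A * ((1 + ‖z.1‖) ^ (2 * N))⁻¹) * (B * ((1 + ‖z.2‖) ^ (2 * N))⁻¹) := by gcongr
    _ = _ := by
      rw [mul_pow, Real.sq_sqrt (by positivity), mul_pow, ← inv_pow, ← inv_pow, ← inv_pow,
        ← inv_pow, ← pow_mul, ← pow_mul, mul_comm N 2]
      ring

theorem integrable_stft (h g : 𝓢(E, ℂ)) : Integrable (stft h g) := by
  obtain ⟨C, hC0, hC⟩ := exists_norm_stft_le h g (Module.finrank ℝ E + 1)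
  have h1 : Integrable fun x : E => ((1 + ‖x‖) ^ (Module.finrank ℝ E + 1))⁻¹ := by
    have := integrable_one_add_norm (E := E) (μ := volume)
      (r := ((Module.finrank ℝ E + 1 : ℕ) : ℝ)) (by push_cast; linarith)
    refine this.congr (Filter.Eventually.of_forall fun x => ?_)
    simp only
    rw [Real.rpow_neg (by positivity), Real.rpow_natCast]
  have h2 := (h1.mul_prod h1).const_mul C
  exact h2.mono' (stronglyMeasurable_stft h.continuous.aestronglyMeasurable g).aestronglyMeasurable
    (Filter.Eventually.of_forall hC)

end TimeFrequency

/-! ### Gaussians as Schwartz functions -/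

section Gaussian

variable {E : Type*} [NormedAddCommGroup E] [InnerProductSpace ℝ E]

/-- Bound the power by m! e^{1+r}, then complete the square: r - br² ≤ 1/(4b). -/
theorem one_add_pow_mul_exp_neg_sq_le {b r : ℝ} (hb : 0 < b) (hr : 0 ≤ r) (m : ℕ) :
    (1 + r) ^ m * Real.exp (-b * r ^ 2) ≤ m.factorial * Real.exp (1 + 1 / (4 * b)) := by
  have h1 : (1 + r) ^ m ≤ m.factorial * Real.exp (1 + r) := by
    have := Real.pow_div_factorial_le_exp (1 + r) (by positivity) m
    rwa [div_le_iff₀' (by positivity)] at this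
  calc (1 + r) ^ m * Real.exp (-b * r ^ 2)
      ≤ m.factorial * Real.exp (1 + r) * Real.exp (-b * r ^ 2) := by gcongr
    _ = m.factorial * Real.exp (1 + r + -b * r ^ 2) := by rw [mul_assoc, ← Real.exp_add]
    _ ≤ _ := by
      refine mul_le_mul_of_nonneg_left (Real.exp_le_exp.2 ?_) (by positivity)
      have : 1 / (4 * b) - (r - b * r ^ 2) = b * (r - 1 / (2 * b)) ^ 2 := by
        field_simp
        ring
      nlinarith [mul_nonneg hb.le (sq_nonneg (r - 1 / (2 * b)))]

/-- The real Gaussian `x ↦ exp (-b ‖x‖ ^ 2)` as a Schwartz function. -/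
noncomputable def realGaussian (E : Type*) [NormedAddCommGroup E] [InnerProductSpace ℝ E]
    {b : ℝ} (hb : 0 < b) : 𝓢(E, ℝ) where
  toFun x := Real.exp (-b * ‖x‖ ^ 2)
  smooth' := by
    have := contDiff_norm_sq ℝ (E := E) (n := ((⊤ : ℕ∞) : WithTop ℕ∞))
    fun_prop
  decay' k n := by
    obtain ⟨l, C, hC, hq⟩ :=
      (Function.hasTemperateGrowth_norm_sq (H := E)).norm_iteratedFDeriv_le_uniform n
    refine ⟨n.factorial * (1 + b) ^ n * (C + 1) ^ n *
      ((k + l * n).factorial * Real.exp (1 + 1 / (4 * b))), fun x => ?_⟩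
    have houter : ∀ i ≤ n, ‖iteratedFDeriv ℝ i (fun s : ℝ => Real.exp (-b * s)) (‖x‖ ^ 2)‖ ≤
        (1 + b) ^ n * Real.exp (-b * ‖x‖ ^ 2) := by
      intro i hi
      rw [norm_iteratedFDeriv_eq_norm_iteratedDeriv, iteratedDeriv_exp_const_mul, norm_mul,
        norm_pow, norm_neg, Real.norm_of_nonneg hb.le, Real.norm_of_nonneg (Real.exp_nonneg _)]
      gcongr
      calc b ^ i ≤ (1 + b) ^ i := by gcongr; linarith
        _ ≤ (1 + b) ^ n := pow_le_pow_right₀ (by linarith) hi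
    -- The bound for derivatives of a composition asks for a single D with i-th derivative at most
    -- D^i; enlarging `C` to `C + 1` makes D ≥ 1, so that one D serves every i ≥ 1.
    have hinner : ∀ i, 1 ≤ i → i ≤ n → ‖iteratedFDeriv ℝ i (fun y : E => ‖y‖ ^ 2) x‖ ≤
        ((C + 1) * (1 + ‖x‖) ^ l) ^ i := by
      intro i hi1 hi2
      refine (hq i hi2 x).trans ?_
      rw [mul_pow]
      have hi0 : i ≠ 0 := by omega
      gcongr
      · exact le_trans (by simp) (le_self_pow₀ (by simp [hC]) hi0)
      · refine le_self_pow₀ (one_le_pow₀ ?_) hi0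
        simp only [le_add_iff_nonneg_right, norm_nonneg]
    have key := norm_iteratedFDeriv_comp_le (g := fun s : ℝ => Real.exp (-b * s))
      (f := fun y : E => ‖y‖ ^ 2) (n := n) (N := ((⊤ : ℕ∞) : WithTop ℕ∞)) (by fun_prop)
      (contDiff_norm_sq ℝ) (mod_cast le_top) x houter hinner
    calc ‖x‖ ^ k * ‖iteratedFDeriv ℝ n (fun x : E => Real.exp (-b * ‖x‖ ^ 2)) x‖
        ≤ (1 + ‖x‖) ^ k * (n.factorial * ((1 + b) ^ n * Real.exp (-b * ‖x‖ ^ 2)) *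
          ((C + 1) * (1 + ‖x‖) ^ l) ^ n) := by
          gcongr
          · linarith
          · exact key
      _ = n.factorial * (1 + b) ^ n * (C + 1) ^ n *
          ((1 + ‖x‖) ^ (k + l * n) * Real.exp (-b * ‖x‖ ^ 2)) := by
          rw [mul_pow, pow_add, pow_mul]
          ring
      _ ≤ _ := by
          refine mul_le_mul_of_nonneg_left ?_ (by positivity)
          exact one_add_pow_mul_exp_neg_sq_le hb (norm_nonneg x) _

/-- The Gaussian `x ↦ c exp (-b ‖x‖ ^ 2)` as a complex-valued Schwartz function. -/
noncomputable def gaussian (E : Type*) [NormedAddCommGroup E] [InnerProductSpace ℝ E]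
    {b : ℝ} (hb : 0 < b) (c : ℂ) : 𝓢(E, ℂ) :=
  c • SchwartzMap.postcompCLM (𝕜 := ℝ) ofRealCLM (realGaussian E hb)

theorem gaussian_apply {b : ℝ} (hb : 0 < b) (c : ℂ) (x : E) :
    gaussian E hb c x = c * cexp (-b * ‖x‖ ^ 2) := by
  change c * ((Real.exp (-b * ‖x‖ ^ 2) : ℝ) : ℂ) = _
  push_cast
  rfl

end Gaussian

/-! ### Linear phase-space parameters and the two exponent identities -/

namespace TwistedModulation

open scoped RealInnerProductSpace

variable {n : ℕ}

/-- The linear map `J (x, u) = (u, -x)`, for which `[ξ, η] = J ξ · η`. -/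
noncomputable def rotJ : R2n n →ₗ[ℝ] R2n n where
  toFun ξ := WithLp.toLp 2 (Sum.elim (fun j => ξ (Sum.inr j)) fun j => -ξ (Sum.inl j))
  map_add' ξ η := by
    ext k
    rcases k with j | j <;> simp [add_comm]
  map_smul' c ξ := by
    ext k
    rcases k with j | j <;> simp

@[simp] theorem rotJ_inl (ξ : R2n n) (j : Fin n) : rotJ ξ (Sum.inl j) = ξ (Sum.inr j) := rfl

@[simp] theorem rotJ_inr (ξ : R2n n) (j : Fin n) : rotJ ξ (Sum.inr j) = -ξ (Sum.inl j) := rfl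

theorem rotJ_rotJ (ξ : R2n n) : rotJ (rotJ ξ) = -ξ := by
  ext k
  rcases k with j | j <;> simp

/-- The translation parameter of the operator `Π_λ(ξ, η)`. -/
noncomputable def shiftPos (r : ℝ) (ξ η : R2n n) : R2n n := ξ + r • rotJ η

/-- The modulation parameter of the operator `Π_λ(ξ, η)`. -/
noncomputable def shiftFreq (a r : ℝ) (ξ η : R2n n) : R2n n := (r * a) • rotJ ξ - a • η

/-- The exponent of the integral kernel of the twisted Bargmann transform. -/
noncomputable def kernelExp (a r : ℝ) (ζ : C2n n) (t : R2n n) : ℂ :=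
  (a / 2 * (1 + r ^ 2) / 2 : ℂ) * (ζ ⬝ᵥ ζ) - (a / 2 : ℂ) * ((ζ - ofR t) ⬝ᵥ (ζ - ofR t)) -
    I * (r * a) * symp ζ (ofR t)

theorem inner_eq_sum (s t : R2n n) :
    ((⟪s, t⟫ : ℝ) : ℂ) =
      ∑ j, ((s (Sum.inl j) : ℂ) * t (Sum.inl j) + (s (Sum.inr j) : ℂ) * t (Sum.inr j)) := by
  rw [PiLp.inner_apply, Fintype.sum_sum_type, ← Finset.sum_add_distrib]
  push_cast
  refine Finset.sum_congr rfl fun j _ => ?_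
  simp [mul_comm]

theorem dotProduct_eq_sum (s t : C2n n) :
    s ⬝ᵥ t = ∑ j, (s (Sum.inl j) * t (Sum.inl j) + s (Sum.inr j) * t (Sum.inr j)) := by
  rw [dotProduct, Fintype.sum_sum_type, ← Finset.sum_add_distrib]

theorem absSq_cplx (ξ η : R2n n) :
    (absSq (cplx ξ η) : ℂ) = ∑ j, ((ξ (Sum.inl j) : ℂ) ^ 2 + (η (Sum.inl j) : ℂ) ^ 2 +
      ((ξ (Sum.inr j) : ℂ) ^ 2 + (η (Sum.inr j) : ℂ) ^ 2)) := by
  have h : ∀ k, ‖cplx ξ η k‖ ^ 2 = ξ k ^ 2 + η k ^ 2 := fun k => by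
    rw [← Complex.normSq_eq_norm_sq, Complex.normSq_apply]
    simp [cplx]
    ring
  rw [absSq, Fintype.sum_sum_type, ← Finset.sum_add_distrib]
  simp only [h]
  push_cast
  rfl

theorem symp_re_im_cplx (ξ η : R2n n) :
    ((symp (fun k => (cplx ξ η k).re) (fun k => (cplx ξ η k).im) : ℝ) : ℂ) =
      ∑ j, ((ξ (Sum.inr j) : ℂ) * η (Sum.inl j) - (η (Sum.inr j) : ℂ) * ξ (Sum.inl j)) := by
  simp [symp, cplx]

/-- The intertwining relation at the level of exponents: the Weyl phase and the translated kernel on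
the left, the shifted kernel and the multipliers of `rho` on the right. It is a polynomial identity
in each coordinate pair, modulo I² = -1. -/
theorem kernelExp_add (a r : ℝ) (ζ : C2n n) (ξ η t : R2n n) :
    -I / 2 * (⟪shiftPos r ξ η, shiftFreq a r ξ η⟫ : ℝ) +
        I * (⟪t + shiftPos r ξ η, shiftFreq a r ξ η⟫ : ℝ) +
        kernelExp a r ζ (t + shiftPos r ξ η) =
      kernelExp a r (ζ - cplx ξ η) t +
        ((a / 2 * (1 + r ^ 2) : ℂ) * (ζ ⬝ᵥ fun k => conj (cplx ξ η k)) -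
          I * (r * a) * symp ζ (fun k => conj (cplx ξ η k)) -
          (a / 2 * (1 + r ^ 2) / 2 : ℂ) * absSq (cplx ξ η) +
          (r * a : ℂ) * (symp (fun k => (cplx ξ η k).re) (fun k => (cplx ξ η k).im) : ℝ)) := by
  simp only [kernelExp, inner_eq_sum, dotProduct_eq_sum, absSq_cplx, symp_re_im_cplx]
  simp only [symp, Finset.mul_sum, ← Finset.sum_add_distrib, ← Finset.sum_sub_distrib]
  refine Finset.sum_congr rfl fun j _ => ?_
  simp only [shiftPos, shiftFreq, cplx, ofR, PiLp.add_apply, PiLp.sub_apply, PiLp.smul_apply,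
    Pi.sub_apply, rotJ_inl, rotJ_inr, smul_eq_mul, map_add, map_mul, conj_ofReal, conj_I]
  push_cast
  linear_combination (-((a / 2 * (1 + r ^ 2) - a) / 2 *
    ((η (Sum.inl j) : ℂ) ^ 2 + (η (Sum.inr j) : ℂ) ^ 2) +
    r * a * (η (Sum.inr j) * t (Sum.inl j) - η (Sum.inl j) * t (Sum.inr j)) +
    r * a * (ζ (Sum.inr j) * η (Sum.inl j) - ζ (Sum.inl j) * η (Sum.inr j)))) * I_sq

/-- On the left is the exponent of the conjugate of a Weyl-shifted Gaussian; on the right, the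
Bargmann kernel plus the exponent of the square root of the weight. -/
theorem kernelExp_cplx (a r : ℝ) (ξ η t : R2n n) :
    I / 2 * (⟪shiftPos r ξ η, shiftFreq a r ξ η⟫ : ℝ) -
        I * (⟪t, shiftFreq a r ξ η⟫ : ℝ) -
        (a / 2 : ℂ) * (⟪t - shiftPos r ξ η, t - shiftPos r ξ η⟫ : ℝ) =
      kernelExp a r (cplx ξ η) t +
        (-(a / 2 * (1 + r ^ 2) / 2 : ℂ) * absSq (cplx ξ η) +
          (r * a : ℂ) * (symp (fun k => (cplx ξ η k).re) (fun k => (cplx ξ η k).im) : ℝ)) := by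
  simp only [kernelExp, inner_eq_sum, dotProduct_eq_sum, absSq_cplx, symp_re_im_cplx]
  simp only [symp, Finset.mul_sum, ← Finset.sum_add_distrib, ← Finset.sum_sub_distrib]
  refine Finset.sum_congr rfl fun j _ => ?_
  simp only [shiftPos, shiftFreq, cplx, ofR, PiLp.add_apply, PiLp.sub_apply, PiLp.smul_apply,
    Pi.sub_apply, rotJ_inl, rotJ_inr, smul_eq_mul]
  push_cast
  linear_combination (-((a / 2 * (1 + r ^ 2) - a) / 2 *
    ((η (Sum.inl j) : ℂ) ^ 2 + (η (Sum.inr j) : ℂ) ^ 2) -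
    r * a * (η (Sum.inr j) * t (Sum.inl j) - η (Sum.inl j) * t (Sum.inr j)))) * I_sq

/-! ### Hyperbolic parameters and the Gaussian kernel of `B_λ` -/

/-- The width parameter `(λ/2) coth (λ/2)`. -/
noncomputable def widthPar (lam : ℝ) : ℝ := lam / 2 * coth (1 / 2 * lam)

/-- The twist parameter `tanh (λ/2)`. -/
noncomputable def twistPar (lam : ℝ) : ℝ := Real.sinh (1 / 2 * lam) / Real.cosh (1 / 2 * lam)

theorem sinh_ne_zero {x : ℝ} (hx : x ≠ 0) : Real.sinh x ≠ 0 := by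
  rwa [Ne, Real.sinh_eq_zero]

/-- The quotient is even, which is how negative λ is covered in all the positivity statements. -/
theorem div_sinh_pos {x : ℝ} (hx : x ≠ 0) : 0 < x / Real.sinh x := by
  rcases hx.lt_or_gt with h | h
  · exact div_pos_of_neg_of_neg h (Real.sinh_neg_iff.2 h)
  · exact div_pos h (Real.sinh_pos_iff.2 h)

theorem widthPar_pos {lam : ℝ} (h : lam ≠ 0) : 0 < widthPar lam := by
  have h1 : (1 / 2 * lam) ≠ 0 := by simpa using h
  have h2 : widthPar lam = (1 / 2 * lam) / Real.sinh (1 / 2 * lam) * Real.cosh (1 / 2 * lam) := by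
    rw [widthPar, coth]
    ring
  rw [h2]
  exact mul_pos (div_sinh_pos h1) (Real.cosh_pos _)

theorem twistPar_mul_widthPar {lam : ℝ} (h : lam ≠ 0) : twistPar lam * widthPar lam = lam / 2 := by
  have h1 : Real.sinh (1 / 2 * lam) ≠ 0 := sinh_ne_zero (by simpa using h)
  have h2 := (Real.cosh_pos (1 / 2 * lam)).ne'
  rw [twistPar, widthPar, coth]
  field_simp

theorem twistPar_sq_lt_one (lam : ℝ) : twistPar lam ^ 2 < 1 := by
  have h2 := Real.cosh_pos (1 / 2 * lam)
  rw [twistPar, div_pow, div_lt_one (by positivity), Real.cosh_sq]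
  linarith

theorem half_mul_coth {lam : ℝ} (h : lam ≠ 0) :
    lam / 2 * coth lam = widthPar lam / 2 * (1 + twistPar lam ^ 2) := by
  have h1 : Real.sinh (1 / 2 * lam) ≠ 0 := sinh_ne_zero (by simpa using h)
  have h2 := (Real.cosh_pos (1 / 2 * lam)).ne'
  have hs : Real.sinh lam = 2 * Real.sinh (1 / 2 * lam) * Real.cosh (1 / 2 * lam) := by
    rw [← Real.sinh_two_mul]
    ring_nf
  have hc : Real.cosh lam = Real.cosh (1 / 2 * lam) ^ 2 + Real.sinh (1 / 2 * lam) ^ 2 := by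
    rw [← Real.cosh_two_mul]
    ring_nf
  rw [widthPar, twistPar, coth, coth, hs, hc]
  field_simp

theorem cConst_pos (n : ℕ) {lam : ℝ} (h : lam ≠ 0) : 0 < cConst n lam := by
  have := div_sinh_pos h
  have h2 : cConst n lam = ((4 * Real.pi) ^ n)⁻¹ * (lam / Real.sinh lam) ^ n := by
    rw [cConst, div_pow]
    ring
  rw [h2]
  have := Real.pi_pos
  positivity

/-- The constant factor of the heat kernel at time `1/2`. -/
noncomputable def halfConst (n : ℕ) (lam : ℝ) : ℝ :=
  ((4 * Real.pi) ^ n)⁻¹ * lam ^ n * ((Real.sinh (1 / 2 * lam)) ^ n)⁻¹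

theorem halfConst_pos (n : ℕ) {lam : ℝ} (h : lam ≠ 0) : 0 < halfConst n lam := by
  have := div_sinh_pos (x := 1 / 2 * lam) (by simpa using h)
  have h2 : halfConst n lam =
      ((4 * Real.pi) ^ n)⁻¹ * 2 ^ n * ((1 / 2 * lam) / Real.sinh (1 / 2 * lam)) ^ n := by
    have h3 : lam ^ n = 2 ^ n * (1 / 2 * lam) ^ n := by
      rw [← mul_pow]
      ring
    rw [halfConst, div_pow, h3]
    ring
  rw [h2]
  have := Real.pi_pos
  positivity

theorem heatKernel_half (lam : ℝ) (ζ : C2n n) :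
    heatKernel lam (1 / 2) ζ = halfConst n lam * cexp (-(widthPar lam / 2 : ℂ) * (ζ ⬝ᵥ ζ)) := by
  rw [heatKernel, halfConst, widthPar]
  congr 3
  push_cast
  ring

/-- The factor `c_λ` cancels the constant of the heat kernel at time 1, leaving exp((λ/4) coth λ
ζ·ζ); the half-argument formula for coth λ merges it with the kernel at time 1/2. -/
theorem bargmann_eq {lam : ℝ} (h : lam ≠ 0) (f : R2n n → ℂ) (ζ : C2n n) :
    bargmann lam f ζ =
      halfConst n lam * ∫ t, f t * cexp (kernelExp (widthPar lam) (twistPar lam) ζ t) := by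
  have hc : (cConst n lam : ℂ) ≠ 0 := ofReal_ne_zero.2 (cConst_pos n h).ne'
  have h1 : (cConst n lam : ℂ) * (heatKernel lam 1 ζ)⁻¹ =
      cexp ((widthPar lam / 2 * (1 + twistPar lam ^ 2) / 2 : ℂ) * (ζ ⬝ᵥ ζ)) := by
    have h2 : heatKernel lam 1 ζ = (cConst n lam : ℂ) *
        cexp (-((widthPar lam / 2 * (1 + twistPar lam ^ 2) / 2 : ℂ) * (ζ ⬝ᵥ ζ))) := by
      have h3 : lam / 4 * coth lam = widthPar lam / 2 * (1 + twistPar lam ^ 2) / 2 := by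
        rw [← half_mul_coth h]
        ring
      rw [heatKernel, cConst, one_mul, h3]
      congr 2
      push_cast
      ring
    rw [h2, mul_inv, ← mul_assoc, mul_inv_cancel₀ hc, one_mul, ← Complex.exp_neg, neg_neg]
  rw [bargmann, h1, heatConv, ← integral_const_mul, ← integral_const_mul]
  refine integral_congr_ae (Filter.Eventually.of_forall fun t => ?_)
  have h4 : ((lam / 2 : ℝ) : ℂ) = (twistPar lam * widthPar lam : ℂ) := by
    rw [← twistPar_mul_widthPar h]
    push_cast
    rfl
  simp only [heatKernel_half, h4, kernelExp]
  rw [Complex.exp_sub, Complex.exp_sub, neg_mul, Complex.exp_neg, neg_mul, neg_mul,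
    Complex.exp_neg]
  field_simp

/-- The linear map taking `(ξ, η)` to the position and frequency of `Π_λ(ξ, η)`. -/
noncomputable def shiftMap (a r : ℝ) : (R2n n × R2n n) →ₗ[ℝ] (R2n n × R2n n) :=
  (LinearMap.fst ℝ _ _ + r • rotJ.comp (LinearMap.snd ℝ _ _)).prod
    -- The factor (2π)⁻¹ passes from e^{iy·t} to the normalization e^{2πi⟪t, ω⟫} of `tfShift`.
    ((2 * Real.pi)⁻¹ • ((r * a) • rotJ.comp (LinearMap.fst ℝ _ _) - a • LinearMap.snd ℝ _ _))

theorem shiftMap_apply (a r : ℝ) (ξ η : R2n n) :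
    shiftMap a r (ξ, η) = (shiftPos r ξ η, (2 * Real.pi)⁻¹ • shiftFreq a r ξ η) := rfl

/-- Vanishing position gives ξ = -rJη; since J² = -1, vanishing frequency becomes a(r² - 1)η = 0. -/
theorem shiftMap_injective {a r : ℝ} (ha : a ≠ 0) (hr : r ^ 2 < 1) :
    Function.Injective (shiftMap (n := n) a r) := by
  rw [← LinearMap.ker_eq_bot, LinearMap.ker_eq_bot']
  rintro ⟨ξ, η⟩ h
  rw [shiftMap_apply, Prod.mk_eq_zero, smul_eq_zero] at h
  obtain ⟨h1, h2⟩ := h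
  have h2 : shiftFreq a r ξ η = 0 := h2.resolve_left (inv_ne_zero Real.two_pi_pos.ne')
  have h3 : ξ = -(r • rotJ η) := eq_neg_of_add_eq_zero_left h1
  have h4 : (a * (r ^ 2 - 1)) • η = 0 := by
    rw [shiftFreq, h3, map_neg, map_smul, rotJ_rotJ] at h2
    rw [← h2]
    module
  have h5 : a * (r ^ 2 - 1) ≠ 0 := mul_ne_zero ha (by linarith)
  have h6 : η = 0 := (smul_eq_zero.1 h4).resolve_left h5
  simp [h3, h6]

/-! ### Weyl operators, Gaussian window and identification of `Π_λ` -/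

/-- The Weyl operator `g ↦ e^{-i x·y/2} e^{i y·t} g (t - x)` that realizes `Π_λ(ξ, η)`. -/
noncomputable def weylShift (lam : ℝ) (ξ η : R2n n) (g : 𝓢(R2n n, ℂ)) : 𝓢(R2n n, ℂ) :=
  cexp (-I / 2 * (⟪shiftPos (twistPar lam) ξ η,
      shiftFreq (widthPar lam) (twistPar lam) ξ η⟫ : ℝ)) •
    tfShift (shiftPos (twistPar lam) ξ η)
      ((2 * Real.pi)⁻¹ • shiftFreq (widthPar lam) (twistPar lam) ξ η) g

theorem weylShift_apply (lam : ℝ) (ξ η : R2n n) (g : 𝓢(R2n n, ℂ)) (t : R2n n) :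
    weylShift lam ξ η g t =
      cexp (-I / 2 * (⟪shiftPos (twistPar lam) ξ η,
          shiftFreq (widthPar lam) (twistPar lam) ξ η⟫ : ℝ) +
        I * (⟪t, shiftFreq (widthPar lam) (twistPar lam) ξ η⟫ : ℝ)) *
      g (t - shiftPos (twistPar lam) ξ η) := by
  rw [weylShift, smul_apply, tfShift_apply, smul_eq_mul, ← mul_assoc, Complex.exp_add]
  congr 2
  rw [Real.fourierChar_apply, inner_smul_right]
  congr 1
  have : (Real.pi : ℂ) ≠ 0 := ofReal_ne_zero.2 Real.pi_ne_zero
  push_cast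
  field_simp

theorem bargmann_weylShift {lam : ℝ} (h : lam ≠ 0) (ξ η : R2n n) (g : 𝓢(R2n n, ℂ)) :
    bargmann lam (weylShift lam ξ η g) = rho lam (cplx ξ η) (bargmann lam g) := by
  ext ζ
  have hb : ((lam / 2 : ℝ) : ℂ) = (twistPar lam * widthPar lam : ℂ) := by
    rw [← twistPar_mul_widthPar h]
    push_cast
    rfl
  have hc : ((lam / 2 * coth lam : ℝ) : ℂ) =
      (widthPar lam / 2 * (1 + twistPar lam ^ 2) : ℂ) := by
    rw [half_mul_coth h]
    push_cast
    rfl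
  have hc2 : -(lam / 4) * coth lam = -(lam / 2 * coth lam) / 2 := by ring
  rw [rho, bargmann_eq h, bargmann_eq h, hb, hc, hc2]
  simp only [mul_assoc]
  congr 1
  rw [← integral_mul_const, ← integral_add_right_eq_self _ (shiftPos (twistPar lam) ξ η)]
  refine integral_congr_ae (Filter.Eventually.of_forall fun t => ?_)
  simp only [weylShift_apply, add_sub_cancel_right]
  have key := kernelExp_add (widthPar lam) (twistPar lam) ζ ξ η t
  rw [mul_comm (cexp _) (g t), mul_assoc, mul_assoc, ← Complex.exp_add, key]
  congr 1
  rw [ofReal_exp, ofReal_exp, ← Complex.exp_add, ← Complex.exp_add, ← Complex.exp_add,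
    ← Complex.exp_add]
  congr 1
  rw [ofReal_mul (-(lam / 2 * coth lam) / 2), ofReal_div, ofReal_neg, hc,
    ofReal_mul (lam / 2), hb]
  push_cast
  ring

/-- The Gaussian window `p_{1/2}^λ` as a Schwartz function. -/
noncomputable def window (n : ℕ) {lam : ℝ} (h : lam ≠ 0) : 𝓢(R2n n, ℂ) :=
  gaussian (R2n n) (half_pos (widthPar_pos h)) (halfConst n lam)

theorem window_apply {lam : ℝ} (h : lam ≠ 0) (t : R2n n) :
    window n h t = halfConst n lam * cexp (-(widthPar lam / 2 : ℂ) * (⟪t, t⟫ : ℝ)) := by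
  rw [window, gaussian_apply, real_inner_self_eq_norm_sq]
  push_cast
  rfl

theorem window_ne_zero {lam : ℝ} (h : lam ≠ 0) (t : R2n n) : window n h t ≠ 0 := by
  rw [window_apply]
  exact mul_ne_zero (ofReal_ne_zero.2 (halfConst_pos n h).ne') (Complex.exp_ne_zero _)

theorem window_eq_heatKernel {lam : ℝ} (h : lam ≠ 0) (t : R2n n) :
    window n h t = heatKernel lam (1 / 2) (ofR t) := by
  rw [window_apply, heatKernel_half, inner_eq_sum, dotProduct_eq_sum]
  rfl

theorem sqrt_weight {lam : ℝ} (h : lam ≠ 0) (ξ η : R2n n) :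
    ((√(weight lam (cplx ξ η)) : ℝ) : ℂ) = (√(cConst n lam) : ℝ) *
      cexp (-(widthPar lam / 2 * (1 + twistPar lam ^ 2) / 2 : ℂ) * absSq (cplx ξ η) +
        (twistPar lam * widthPar lam : ℂ) *
          (symp (fun k => (cplx ξ η k).re) (fun k => (cplx ξ η k).im) : ℝ)) := by
  have hw : weight lam (cplx ξ η) = cConst n lam *
      Real.exp (-(widthPar lam / 2 * (1 + twistPar lam ^ 2)) * absSq (cplx ξ η) +
        2 * (twistPar lam * widthPar lam) *
          symp (fun k => (cplx ξ η k).re) (fun k => (cplx ξ η k).im)) := by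
    rw [weight, mul_assoc, ← Real.exp_add, ← half_mul_coth h, twistPar_mul_widthPar h]
    congr 3 <;> ring
  rw [hw, Real.sqrt_mul (cConst_pos n h).le, ← Real.exp_half, ofReal_mul, ofReal_exp]
  congr 2
  push_cast
  ring

/-- The integrands agree pointwise by `kernelExp_cplx`, so `f` may be arbitrary; this serves both L²
functions and the injectivity of `B_λ` on Schwartz functions. -/
theorem integral_mul_conj_weylShift_window {lam : ℝ} (h : lam ≠ 0) (f : R2n n → ℂ)
    (ξ η : R2n n) :
    (√(cConst n lam) : ℝ) * ∫ t, f t * conj (weylShift lam ξ η (window n h) t) =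
      bargmann lam f (cplx ξ η) * (√(weight lam (cplx ξ η)) : ℝ) := by
  rw [sqrt_weight h, bargmann_eq h, mul_left_comm]
  congr 1
  rw [mul_assoc, ← integral_mul_const, ← integral_const_mul]
  refine integral_congr_ae (Filter.Eventually.of_forall fun t => ?_)
  simp only [weylShift_apply, window_apply]
  rw [mul_assoc, ← Complex.exp_add, ← kernelExp_cplx]
  rw [mul_left_comm, ← Complex.exp_add, map_mul, conj_ofReal, ← Complex.exp_conj, mul_left_comm]
  congr 3
  simp only [map_add, map_mul, map_div₀, map_neg, conj_I, conj_ofReal, map_ofNat]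
  ring

theorem integral_mul_conj_weylShift (lam : ℝ) (f : R2n n → ℂ) (g : 𝓢(R2n n, ℂ)) (ξ η : R2n n) :
    ∫ t, f t * conj (weylShift lam ξ η g t) =
      conj (cexp (-I / 2 * (⟪shiftPos (twistPar lam) ξ η,
        shiftFreq (widthPar lam) (twistPar lam) ξ η⟫ : ℝ))) *
      stft f g (shiftMap (widthPar lam) (twistPar lam) (ξ, η)) := by
  rw [stft, ← integral_const_mul]
  refine integral_congr_ae (Filter.Eventually.of_forall fun t => ?_)
  simp only [weylShift, smul_apply, smul_eq_mul, map_mul, shiftMap_apply]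
  ring

/-- Since `shiftMap` is onto, `B_λ g` determines the whole short-time Fourier transform of `g` with
Gaussian window. Its slice at position 0 is the Fourier transform of `g` times the conjugate window,
and the window has no zeros. -/
theorem bargmann_injective {lam : ℝ} (hlam : lam ≠ 0) :
    Function.Injective fun g : 𝓢(R2n n, ℂ) => bargmann lam (g : R2n n → ℂ) := by
  intro g₁ g₂ h
  simp only at h
  have hc : ((√(cConst n lam) : ℝ) : ℂ) ≠ 0 :=
    ofReal_ne_zero.2 (Real.sqrt_pos.2 (cConst_pos n hlam)).ne'
  have hA : Function.Surjective (shiftMap (n := n) (widthPar lam) (twistPar lam)) :=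
    LinearMap.injective_iff_surjective.1
      (shiftMap_injective (widthPar_pos hlam).ne' (twistPar_sq_lt_one lam))
  have h1 : ∀ z, stft g₁ (window n hlam) z = stft g₂ (window n hlam) z := by
    intro z
    obtain ⟨⟨ξ, η⟩, rfl⟩ := hA z
    have e1 := integral_mul_conj_weylShift_window hlam g₁ ξ η
    have e2 := integral_mul_conj_weylShift_window hlam g₂ ξ η
    rw [h, ← e2] at e1
    have e3 := mul_left_cancel₀ hc e1
    rw [integral_mul_conj_weylShift, integral_mul_conj_weylShift] at e3
    exact mul_left_cancel₀ (by simp [← Complex.exp_conj]) e3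
  have h2 : ∀ g : 𝓢(R2n n, ℂ), ∀ ω, stft g (window n hlam) (0, ω) =
      FourierTransform.fourier (mulConj g (window n hlam)) ω := by
    intro g ω
    have hm : (mulConj g (window n hlam) : R2n n → ℂ) =
        fun t => g t * conj (window n hlam (t - 0)) := by
      funext t
      rw [mulConj_apply, sub_zero]
    rw [stft_eq_fourier, SchwartzMap.fourier_coe, hm]
  have h3 : mulConj g₁ (window n hlam) = mulConj g₂ (window n hlam) := by
    have h4 : FourierTransform.fourier (mulConj g₁ (window n hlam)) =
        FourierTransform.fourier (mulConj g₂ (window n hlam)) := by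
      refine DFunLike.ext _ _ fun ω => ?_
      rw [← h2, ← h2, h1]
    simpa only [FourierTransform.fourierInv_fourier_eq] using
      congrArg FourierTransformInv.fourierInv h4
  ext t
  have h4 := DFunLike.congr_fun h3 t
  rw [mulConj_apply, mulConj_apply] at h4
  exact mul_right_cancel₀ ((map_ne_zero _).2 (window_ne_zero hlam t)) h4

/-- The Weyl shift is a preimage by the intertwining relation, and injectivity forces
`Function.invFun` to return it. -/
theorem repPi_eq_weylShift {lam : ℝ} (h : lam ≠ 0) (ξ η : R2n n) (g : 𝓢(R2n n, ℂ)) :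
    repPi lam (cplx ξ η) g = weylShift lam ξ η g := by
  rw [repPi, ← bargmann_weylShift h]
  exact Function.leftInverse_invFun (bargmann_injective h) (weylShift lam ξ η g)

theorem matrixCoeff_eq_integral {lam : ℝ} (h : lam ≠ 0)
    (f : Lp ℂ 2 (volume : Measure (R2n n))) (g : 𝓢(R2n n, ℂ)) (ξ η : R2n n) :
    matrixCoeff lam (f : 𝓢'(R2n n, ℂ)) g ξ η =
      ∫ t, (f : R2n n → ℂ) t * conj (weylShift lam ξ η g t) := by
  rw [matrixCoeff, repPi_eq_weylShift h, pairing, Lp.toTemperedDistribution_apply]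
  refine integral_congr_ae (Filter.Eventually.of_forall fun t => ?_)
  change conj (weylShift lam ξ η g t) * f t = _
  rw [mul_comm]

theorem sqrt_cConst_mul_matrixCoeff_window {lam : ℝ} (h : lam ≠ 0)
    (f : Lp ℂ 2 (volume : Measure (R2n n))) (ξ η : R2n n) :
    (√(cConst n lam) : ℝ) * matrixCoeff lam (f : 𝓢'(R2n n, ℂ)) (window n h) ξ η =
      bargmann lam f (cplx ξ η) * (√(weight lam (cplx ξ η)) : ℝ) := by
  rw [matrixCoeff_eq_integral h, integral_mul_conj_weylShift_window]

theorem matrixCoeff_eq_stft {lam : ℝ} (h : lam ≠ 0)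
    (f : Lp ℂ 2 (volume : Measure (R2n n))) (g : 𝓢(R2n n, ℂ)) (ξ η : R2n n) :
    matrixCoeff lam (f : 𝓢'(R2n n, ℂ)) g ξ η =
      conj (cexp (-I / 2 * (⟪shiftPos (twistPar lam) ξ η,
        shiftFreq (widthPar lam) (twistPar lam) ξ η⟫ : ℝ))) *
      stft f g (shiftMap (widthPar lam) (twistPar lam) (ξ, η)) := by
  rw [matrixCoeff_eq_integral h, integral_mul_conj_weylShift]

/-! ### Independence of the window -/

theorem MemMixedLp.const_mul {p q : ℝ≥0∞} {F : R2n n → R2n n → ℂ} (hF : MemMixedLp p q F) (c : ℂ) :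
    MemMixedLp p q fun ξ η => c * F ξ η := by
  refine ⟨hF.1.const_mul c, ?_⟩
  have h1 : ∀ η, eLpNorm (fun ξ => c * F ξ η) p volume ≤
      (‖c‖₊ : ℝ≥0∞) * eLpNorm (fun ξ => F ξ η) p volume := fun η =>
    eLpNorm_le_mul_eLpNorm_of_ae_le_mul' (Filter.Eventually.of_forall fun ξ => by
      rw [enorm_mul, enorm_eq_nnnorm c]) p
  have h2 : mixedNorm p q (fun ξ η => c * F ξ η) ≤ (‖c‖₊ : ℝ≥0∞) * mixedNorm p q F :=
    eLpNorm_le_mul_eLpNorm_of_ae_le_mul' (Filter.Eventually.of_forall h1) q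
  exact h2.trans_lt (ENNReal.mul_lt_top ENNReal.coe_lt_top hF.2)

theorem isAddHaarMeasure_volume_prod (E : Type*) [NormedAddCommGroup E] [InnerProductSpace ℝ E]
    [FiniteDimensional ℝ E] [MeasurableSpace E] [BorelSpace E] :
    (volume : Measure (E × E)).IsAddHaarMeasure :=
  Measure.prod.instIsAddHaarMeasure _ _

theorem isNegInvariant_volume_prod (E : Type*) [NormedAddCommGroup E] [InnerProductSpace ℝ E]
    [FiniteDimensional ℝ E] [MeasurableSpace E] [BorelSpace E] :
    (volume : Measure (E × E)).IsNegInvariant := by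
  have := isAddHaarMeasure_volume_prod E
  infer_instance

theorem exists_lintegral_comp_linearMap {V : Type*} [NormedAddCommGroup V] [NormedSpace ℝ V]
    [FiniteDimensional ℝ V] [MeasurableSpace V] [BorelSpace V] (μ : Measure V) [μ.IsAddHaarMeasure]
    {A : V →ₗ[ℝ] V} (hA : Function.Injective A) :
    ∃ c : ℝ≥0∞, c ≠ 0 ∧ c ≠ ∞ ∧ ∀ φ : V → ℝ≥0∞, Measurable φ →
      ∫⁻ v, φ (A v) ∂μ = c * ∫⁻ v, φ v ∂μ := by
  have hdet : LinearMap.det A ≠ 0 := by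
    have := (LinearEquiv.ofInjectiveEndo A hA).isUnit_det'
    exact this.ne_zero
  refine ⟨ENNReal.ofReal |(LinearMap.det A)⁻¹|, ?_, ENNReal.ofReal_ne_top, fun φ hφ => ?_⟩
  · simpa using hdet
  · have hAm : Measurable A := A.continuous_of_finiteDimensional.measurable
    rw [← lintegral_map hφ hAm, Measure.map_linearMap_addHaar_eq_smul_addHaar μ hdet,
      lintegral_smul_measure, smul_eq_mul]

theorem measurable_shiftMap (a r : ℝ) : Measurable (shiftMap (n := n) a r) :=
  (shiftMap a r).continuous_of_finiteDimensional.measurable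

theorem enorm_matrixCoeff {lam : ℝ} (h : lam ≠ 0)
    (f : Lp ℂ 2 (volume : Measure (R2n n))) (g : 𝓢(R2n n, ℂ)) (z : R2n n × R2n n) :
    ‖matrixCoeff lam (f : 𝓢'(R2n n, ℂ)) g z.1 z.2‖ₑ =
      ‖stft f g (shiftMap (widthPar lam) (twistPar lam) z)‖ₑ := by
  rw [matrixCoeff_eq_stft h, enorm_mul, RCLike.enorm_conj, ← ofReal_norm (cexp _),
    Complex.norm_exp]
  simp

theorem stronglyMeasurable_matrixCoeff {lam : ℝ} (h : lam ≠ 0)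
    (f : Lp ℂ 2 (volume : Measure (R2n n))) (g : 𝓢(R2n n, ℂ)) :
    StronglyMeasurable fun z : R2n n × R2n n =>
      matrixCoeff lam (f : 𝓢'(R2n n, ℂ)) g z.1 z.2 := by
  simp only [matrixCoeff_eq_stft h]
  have hJ : Continuous (rotJ (n := n)) := rotJ.continuous_of_finiteDimensional
  refine StronglyMeasurable.mul (Continuous.stronglyMeasurable ?_)
    ((stronglyMeasurable_stft (Lp.aestronglyMeasurable f) g).comp_measurable
      (measurable_shiftMap _ _))
  unfold shiftPos shiftFreq
  fun_prop

/-- Membership of the matrix coefficient of an `L²` function in a mixed Lebesgue space does not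
depend on the window. -/
theorem MemMixedLp.change_window {lam : ℝ} (hlam : lam ≠ 0) {p q : ℝ≥0∞} (hp : 1 ≤ p) (hq : 1 ≤ q)
    (f : Lp ℂ 2 (volume : Measure (R2n n))) {g : 𝓢(R2n n, ℂ)} (hg : g ≠ 0) (h : 𝓢(R2n n, ℂ))
    (hf : MemMixedLp p q (matrixCoeff lam (f : 𝓢'(R2n n, ℂ)) g)) :
    MemMixedLp p q (matrixCoeff lam (f : 𝓢'(R2n n, ℂ)) h) := by
  refine ⟨(stronglyMeasurable_matrixCoeff hlam f h).aestronglyMeasurable, ?_⟩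
  set A := shiftMap (n := n) (widthPar lam) (twistPar lam) with hA
  have hAm : Measurable A := measurable_shiftMap _ _
  have := isAddHaarMeasure_volume_prod (R2n n)
  have := isNegInvariant_volume_prod (R2n n)
  obtain ⟨c, hc0, hctop, hc⟩ := exists_lintegral_comp_linearMap
    (volume : Measure (R2n n × R2n n))
    (shiftMap_injective (n := n) (widthPar_pos hlam).ne' (twistPar_sq_lt_one lam))
  rw [← hA] at hc
  set G : ℝ≥0∞ := ENNReal.ofReal (∫ t, ‖g t‖ ^ 2) with hG
  have hG0 : G ≠ 0 := by
    rw [hG, Ne, ENNReal.ofReal_eq_zero, not_le]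
    obtain ⟨t, ht⟩ : ∃ t, g t ≠ 0 := by
      by_contra hcon
      push Not at hcon
      exact hg (DFunLike.ext _ _ hcon)
    exact integral_pos_of_integrable_nonneg_nonzero (x := t) (g.continuous.norm.pow 2)
      ((g.memLp 2 (μ := volume)).integrable_norm_pow two_ne_zero) (fun t => by positivity)
      (by simpa using ht)
  have hGtop : G ≠ ∞ := ENNReal.ofReal_ne_top
  set S : R2n n × R2n n → ℝ≥0∞ := fun w => ‖stft f g w‖ₑ with hS
  have hSm : Measurable S :=
    (stronglyMeasurable_stft (Lp.aestronglyMeasurable f) g).measurable.enorm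
  set K : R2n n × R2n n → ℝ≥0∞ := fun w => ‖stft h g w‖ₑ with hK
  have hKm : Measurable K :=
    (stronglyMeasurable_stft h.continuous.aestronglyMeasurable g).measurable.enorm
  have hKAm : Measurable fun u => K (A (-u)) := hKm.comp (hAm.comp measurable_neg)
  -- The convolving measure: `G` is the constant in Moyal's formula, `c` the Jacobian factor of `A`.
  -- Its mass is finite because `stft h g` is integrable.
  set ν : Measure (R2n n × R2n n) :=
    volume.withDensity fun u => G⁻¹ * c⁻¹ * K (A (-u)) with hν
  have hνm : Measurable fun u => G⁻¹ * c⁻¹ * K (A (-u)) := hKAm.const_mul _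
  have hνuniv : ν Set.univ < ∞ := by
    rw [hν, withDensity_apply _ MeasurableSet.univ, Measure.restrict_univ,
      lintegral_const_mul _ hKAm,
      lintegral_neg_eq_self (fun u => K (A u)), hc K hKm]
    refine ENNReal.mul_lt_top (ENNReal.mul_lt_top (ENNReal.inv_lt_top.2 hG0.bot_lt)
      (ENNReal.inv_lt_top.2 hc0.bot_lt)) (ENNReal.mul_lt_top hctop.lt_top ?_)
    exact (integrable_stft h g).2
  have hbound : ∀ z : R2n n × R2n n, ‖matrixCoeff lam (f : 𝓢'(R2n n, ℂ)) h z.1 z.2‖ₑ ≤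
      ∫⁻ u, S (A (z.1 - u.1, z.2 - u.2)) ∂ν := by
    intro z
    have hm : Measurable fun u : R2n n × R2n n => S (A (z - u)) :=
      hSm.comp (hAm.comp (measurable_const.sub measurable_id))
    have hSKm : Measurable fun u => S (A (z - u)) * K (A (-u)) := hm.mul hKAm
    have h1 := change_of_window (Lp.memLp f) h g (A z)
    -- The substitution w = A(z - u) makes the bound a convolution in (ξ, η) itself, so no mixed
    -- norm has to be transported through `A`.
    have h2 : ∫⁻ w, S w * K (w - A z) = c⁻¹ * ∫⁻ u, S (A (z - u)) * K (A (-u)) := by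
      have hSK : Measurable fun w => S w * K (w - A z) :=
        hSm.mul (hKm.comp (measurable_id.sub measurable_const))
      have h3 := hc _ hSK
      rw [← lintegral_sub_left_eq_self _ z] at h3
      have h4 : ∀ u, A (z - u) - A z = A (-u) := fun u => by
        rw [← map_sub]
        congr 1
        abel
      simp only [h4] at h3
      rw [h3, ← mul_assoc, ENNReal.inv_mul_cancel hc0 hctop, one_mul]
    change G * _ ≤ ∫⁻ w, S w * K (w - A z) at h1
    rw [h2] at h1
    rw [enorm_matrixCoeff hlam]
    calc ‖stft f h (A z)‖ₑ = G⁻¹ * (G * ‖stft f h (A z)‖ₑ) := by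
          rw [← mul_assoc, ENNReal.inv_mul_cancel hG0 hGtop, one_mul]
      _ ≤ G⁻¹ * (c⁻¹ * ∫⁻ u, S (A (z - u)) * K (A (-u))) := by gcongr
      _ = ∫⁻ u, S (A (z.1 - u.1, z.2 - u.2)) ∂ν := by
          change _ = ∫⁻ u, S (A (z - u)) ∂ν
          rw [hν, lintegral_withDensity_eq_lintegral_mul _ hνm hm, ← mul_assoc,
            ← lintegral_const_mul _ hSKm]
          refine lintegral_congr fun u => ?_
          simp only [Pi.mul_apply]
          ring
  have hyoung := mixed_young (μ := (volume : Measure (R2n n))) (ν := ν) hp hq (hSm.comp hAm)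
  have hle : mixedNorm p q (matrixCoeff lam (f : 𝓢'(R2n n, ℂ)) h) ≤
      mixedNorm p q (matrixCoeff lam (f : 𝓢'(R2n n, ℂ)) g) * ν Set.univ := by
    refine le_trans ?_ (hyoung.trans (le_of_eq ?_))
    · exact eLpNorm_mono_enorm fun η => eLpNorm_mono_enorm fun ξ => hbound (ξ, η)
    · rw [mixedNorm]
      congr 2
      funext η
      refine (eLpNorm_congr_enorm_ae (Filter.Eventually.of_forall fun ξ => ?_))
      exact (enorm_matrixCoeff hlam f g (ξ, η)).symm
  exact hle.trans_lt (ENNReal.mul_lt_top hf.2 hνuniv)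

end TwistedModulation

theorem mainTheorem2 (n : ℕ) :
    (∀ (lam : ℝ), lam ≠ 0 → ∀ (p q : ℝ≥0∞), 1 ≤ p → 1 ≤ q →
      ∀ f : Lp ℂ 2 (volume : Measure (TwistedModulation.R2n n)),
        (f : 𝓢'(TwistedModulation.R2n n, ℂ)) ∈
            TwistedModulation.twistedModulationSpace n lam p q ↔
          TwistedModulation.MemMixedLp p q
            (fun ξ η : TwistedModulation.R2n n =>
              ((Real.sqrt (TwistedModulation.weight lam (TwistedModulation.cplx ξ η)) : ℝ) : ℂ) *
                TwistedModulation.bargmann lam (f : TwistedModulation.R2n n → ℂ)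
                  (TwistedModulation.cplx ξ η))) ∧
    (∃ d : ℝ, 0 < d ∧ ∀ (lam : ℝ), lam ≠ 0 →
      ∃ g : 𝓢(TwistedModulation.R2n n, ℂ),
        (∀ x : TwistedModulation.R2n n,
          g x = TwistedModulation.heatKernel lam (1 / 2) (TwistedModulation.ofR x)) ∧
        ∀ (f : Lp ℂ 2 (volume : Measure (TwistedModulation.R2n n)))
          (ξ η : TwistedModulation.R2n n),
          ((d * Real.sqrt (TwistedModulation.cConst n lam) : ℝ) : ℂ) *
              TwistedModulation.matrixCoeff lam (f : 𝓢'(TwistedModulation.R2n n, ℂ)) g ξ η =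
            TwistedModulation.bargmann lam (f : TwistedModulation.R2n n → ℂ)
                (TwistedModulation.cplx ξ η) *
              ((Real.sqrt (TwistedModulation.weight lam (TwistedModulation.cplx ξ η)) : ℝ) : ℂ)) := by
  -- The constant in (b) is 1: the Gaussian identity holds with no further factor.
  refine ⟨fun lam hlam p q hp hq f => ?_, 1, one_pos, fun lam hlam =>
    ⟨TwistedModulation.window n hlam, TwistedModulation.window_eq_heatKernel hlam,
      fun f ξ η => ?_⟩⟩
  · have hc : ((√(TwistedModulation.cConst n lam) : ℝ) : ℂ) ≠ 0 :=
      ofReal_ne_zero.2 (Real.sqrt_pos.2 (TwistedModulation.cConst_pos n hlam)).ne'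
    have hF : (fun ξ η : TwistedModulation.R2n n =>
        ((√(TwistedModulation.weight lam (TwistedModulation.cplx ξ η)) : ℝ) : ℂ) *
          TwistedModulation.bargmann lam f (TwistedModulation.cplx ξ η)) = fun ξ η =>
        ((√(TwistedModulation.cConst n lam) : ℝ) : ℂ) *
          TwistedModulation.matrixCoeff lam (f : 𝓢'(TwistedModulation.R2n n, ℂ))
            (TwistedModulation.window n hlam) ξ η := by
      funext ξ η
      rw [TwistedModulation.sqrt_cConst_mul_matrixCoeff_window, mul_comm]
    rw [hF]
    constructor
    · rintro ⟨g, hg, hgf⟩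
      exact (TwistedModulation.MemMixedLp.change_window hlam hp hq f hg _ hgf).const_mul _
    · intro h
      refine ⟨TwistedModulation.window n hlam, fun h0 => ?_, ?_⟩
      · exact TwistedModulation.window_ne_zero hlam 0 (DFunLike.congr_fun h0 0)
      · have := h.const_mul ((√(TwistedModulation.cConst n lam) : ℝ) : ℂ)⁻¹
        simpa only [inv_mul_cancel_left₀ hc] using this
  · rw [one_mul, TwistedModulation.sqrt_cConst_mul_matrixCoeff_window]
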